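/- A two-counter machine consists of a finite set of states $S=\{1,\dots,m\}$ and an update function $\Gamma:S\times\{0,1\}^2\to S\times\{(-1,0),(0,-1),(0,0),(1,0),(0,1)\}$ that never decrements a zero counter: the first component of the change in $\Gamma(i,0,b)$ and the second component of the change in $\Gamma(i,b,0)$ are never $-1$. A configuration is a triple $(i,C_1,C_2)\in S\times\mathbb{Z}_{\ge 0}^2$; if $\Gamma(i,\mathbf 1\{C_1>0\},\mathbf 1\{C_2>0\})=(i',\delta_1,\delta_2)$, the next configuration is $(i',C_1+\delta_1,C_2+\delta_2)$. An instance is a machine $(S,\Gamma)$ (with any number $m$ of states), an initial configuration $(i^0,C_1^0,C_2^0)$ at time $0$ and a state $i^*\in S$, given to algorithms as the finite list of these data; the question is whether the machine is in state $i^*$ at some time $t\ge 0$. Theorem. This problem is undecidable: there is no algorithm that, given an instance, determines whether the state $i^*$ is reached in finite time. Moreover, without loss of generality it may be assumed that whenever the state $i^*$ is reached, both counters equal $1$. That is, there is an algorithm that turns every instance into an instance which has this property and has the same answer; and there is no algorithm that answers the question correctly on all instances with this property (whatever it does, including not terminating, on the other instances). -/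

import Mathlib

/-- The five admissible changes of the two counters:
`(-1,0)`, `(0,-1)`, `(0,0)`, `(1,0)`, `(0,1)`. -/
inductive CounterMove where
  | dec₁ : CounterMove
  | dec₂ : CounterMove
  | stay : CounterMove
  | inc₁ : CounterMove
  | inc₂ : CounterMove

/-- The effect of a move on the pair of counter values. The subtraction is the ordinary one
wherever a consistent machine uses it. -/
def CounterMove.apply : CounterMove → ℕ × ℕ → ℕ × ℕ
  | .dec₁, c => (c.1 - 1, c.2)
  | .dec₂, c => (c.1, c.2 - 1)
  | .stay, c => c
  | .inc₁, c => (c.1 + 1, c.2)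
  | .inc₂, c => (c.1, c.2 + 1)

/-- A two-counter machine with `m` states. The update function `Γ` reads the state and the two
bits "is the first counter positive", "is the second counter positive". It never attempts to
decrement a counter that equals zero. -/
structure CounterMachine (m : ℕ) where
  Γ : Fin m → Bool → Bool → Fin m × CounterMove
  consistent₁ : ∀ i b, (Γ i false b).2 ≠ CounterMove.dec₁
  consistent₂ : ∀ i b, (Γ i b false).2 ≠ CounterMove.dec₂

/-- One update of a configuration `(i, C₁, C₂)`. -/
def CounterMachine.step {m : ℕ} (M : CounterMachine m) (s : Fin m × ℕ × ℕ) : Fin m × ℕ × ℕ :=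
  let r := M.Γ s.1 (decide (0 < s.2.1)) (decide (0 < s.2.2))
  (r.1, r.2.apply s.2)

/-- The configuration at time `t` when the machine starts from `s`. -/
def CounterMachine.config {m : ℕ} (M : CounterMachine m) (s : Fin m × ℕ × ℕ) (t : ℕ) :
    Fin m × ℕ × ℕ :=
  M.step^[t] s

/-- An instance of the state reachability problem: a machine (with any number of states),
an initial configuration and a designated state. -/
structure CounterInstance where
  m : ℕ
  machine : CounterMachine m
  init : Fin m × ℕ × ℕ
  halt : Fin m

/-- The designated state is reached in finite time. -/
def CounterInstance.Reaches (I : CounterInstance) : Prop :=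
  ∃ t : ℕ, (I.machine.config I.init t).1 = I.halt

/-- Whenever the designated state is reached, both counters are equal to one. -/
def CounterInstance.HaltsWithOnes (I : CounterInstance) : Prop :=
  ∀ t : ℕ, (I.machine.config I.init t).1 = I.halt → (I.machine.config I.init t).2 = (1, 1)

/-! Instances are presented to algorithms as finite data: the list, over all states, of the four
entries `Γ i 0 0, Γ i 0 1, Γ i 1 0, Γ i 1 1`, then the initial configuration and the designated
state. -/

/-- Moves, numbered from 0 to 4. -/
def CounterMove.equivFin : CounterMove ≃ Fin 5 where
  toFun
    | .dec₁ => 0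
    | .dec₂ => 1
    | .stay => 2
    | .inc₁ => 3
    | .inc₂ => 4
  invFun k := match k with
    | 0 => .dec₁
    | 1 => .dec₂
    | 2 => .stay
    | 3 => .inc₁
    | 4 => .inc₂
  left_inv x := by cases x <;> rfl
  right_inv k := by fin_cases k <;> rfl

instance : DecidableEq CounterMove := fun a b =>
  decidable_of_iff (CounterMove.equivFin a = CounterMove.equivFin b)
    CounterMove.equivFin.injective.eq_iff

instance : Primcodable CounterMove := Primcodable.ofEquiv (Fin 5) CounterMove.equivFin

/-- One entry of a transition table: the number of the next state, and the move. -/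
abbrev CounterEntry := ℕ × CounterMove

/-- The entries of one state, for the bit pairs `00, 01, 10, 11`. -/
abbrev CounterRow := CounterEntry × CounterEntry × CounterEntry × CounterEntry

/-- The transition table, the initial configuration, the designated state. -/
abbrev CounterData := List CounterRow × (ℕ × ℕ × ℕ) × ℕ

/-- The finite data that describe an instance. -/
def CounterInstance.toData (I : CounterInstance) : CounterData :=
  let e : Fin I.m → Bool → Bool → CounterEntry := fun i b c =>
    (((I.machine.Γ i b c).1 : ℕ), (I.machine.Γ i b c).2)
  (List.ofFn fun i => (e i false false, e i false true, e i true false, e i true true),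
    ((I.init.1 : ℕ), I.init.2), (I.halt : ℕ))

/-- A row of a machine with `m` states: targets are states, and the row is consistent. -/
def CounterRow.Valid (r : CounterRow) (m : ℕ) : Prop :=
  (r.1.1 < m ∧ r.1.2 ≠ .dec₁ ∧ r.1.2 ≠ .dec₂) ∧
  (r.2.1.1 < m ∧ r.2.1.2 ≠ .dec₁) ∧
  (r.2.2.1.1 < m ∧ r.2.2.1.2 ≠ .dec₂) ∧
  r.2.2.2.1 < m

/-- The data that describe some instance. -/
def CounterData.Valid (d : CounterData) : Prop :=
  (∀ r ∈ d.1, CounterRow.Valid r d.1.length) ∧ d.2.1.1 < d.1.length ∧ d.2.2 < d.1.length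

theorem CounterInstance.toData_valid (I : CounterInstance) : CounterData.Valid I.toData := by
  refine ⟨?_, ?_, ?_⟩
  · intro r hr
    simp only [toData, List.mem_ofFn] at hr
    obtain ⟨i, rfl⟩ := hr
    simp [CounterRow.Valid, toData, I.machine.consistent₁, I.machine.consistent₂]
  · simp [toData]
  · simp [toData]

theorem CounterInstance.toData_injective : Function.Injective CounterInstance.toData := by
  rintro ⟨m, ⟨Γ, h₁, h₂⟩, i, q⟩ ⟨m', ⟨Γ', h₁', h₂'⟩, i', q'⟩ h
  have hm : m = m' := by
    have := congrArg (fun d : CounterData => d.1.length) h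
    simpa [toData] using this
  subst hm
  simp only [toData, Prod.mk.injEq] at h
  obtain ⟨hΓ, ⟨hi, hc⟩, hq⟩ := h
  have hΓ' := List.ofFn_injective hΓ
  have : Γ = Γ' := by
    funext j b c
    have hj := congrFun hΓ' j
    simp only [Prod.mk.injEq] at hj
    cases b <;> cases c <;> exact Prod.ext (Fin.ext (by tauto)) (by tauto)
  subst this
  have e₁ : i = i' := Prod.ext (Fin.ext hi) hc
  have e₂ : q = q' := Fin.ext hq
  subst e₁ e₂
  rfl

theorem CounterInstance.exists_toData (d : CounterData) (hd : CounterData.Valid d) :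
    ∃ I : CounterInstance, I.toData = d := by
  obtain ⟨L, ⟨i, c⟩, q⟩ := d
  obtain ⟨hL, hi, hq⟩ := hd
  have hv : ∀ j : Fin L.length, CounterRow.Valid (L.get j) L.length := fun j =>
    hL _ (List.get_mem L j)
  refine ⟨⟨L.length, ⟨fun j b c => match b, c with
    | false, false => (⟨(L.get j).1.1, (hv j).1.1⟩, (L.get j).1.2)
    | false, true => (⟨(L.get j).2.1.1, (hv j).2.1.1⟩, (L.get j).2.1.2)
    | true, false => (⟨(L.get j).2.2.1.1, (hv j).2.2.1.1⟩, (L.get j).2.2.1.2)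
    | true, true => (⟨(L.get j).2.2.2.1, (hv j).2.2.2⟩, (L.get j).2.2.2.2), ?_, ?_⟩,
    (⟨i, hi⟩, c), ⟨q, hq⟩⟩, ?_⟩
  · intro j b
    cases b
    · exact (hv j).1.2.1
    · exact (hv j).2.1.2
  · intro j b
    cases b
    · exact (hv j).1.2.2
    · exact (hv j).2.2.1.2
  · exact Prod.ext (List.ofFn_get L) rfl

/-- Instances correspond exactly to valid data. -/
noncomputable def CounterInstance.equivData : CounterInstance ≃ {d : CounterData // CounterData.Valid d} :=
  Equiv.ofBijective (fun I => ⟨I.toData, I.toData_valid⟩)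
    ⟨fun _ _ h => toData_injective (congrArg Subtype.val h),
      fun d => (exists_toData d.1 d.2).imp fun _ h => Subtype.ext h⟩

theorem CounterRow.valid_primrec : PrimrecRel CounterRow.Valid := by
  have row : Primrec (fun p : CounterRow × ℕ => p.1) := Primrec.fst
  have bound : Primrec (fun p : CounterRow × ℕ => p.2) := Primrec.snd
  have e₂ := Primrec.snd.comp row
  have e₃ := Primrec.snd.comp e₂
  have lt : ∀ {f : CounterRow × ℕ → CounterEntry}, Primrec f →
      PrimrecPred fun p => (f p).1 < p.2 :=
    fun hf => Primrec.nat_lt.comp (Primrec.fst.comp hf) bound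
  have ne : ∀ {f : CounterRow × ℕ → CounterEntry} (a : CounterMove), Primrec f →
      PrimrecPred fun p => (f p).2 ≠ a :=
    fun a hf => (Primrec.eq.comp (Primrec.snd.comp hf) (Primrec.const a)).not
  have h₁ := Primrec.fst.comp row
  have h₂ := Primrec.fst.comp e₂
  have h₃ := Primrec.fst.comp e₃
  have h₄ := Primrec.snd.comp e₃
  exact ((lt h₁).and ((ne .dec₁ h₁).and (ne .dec₂ h₁))).and
    (((lt h₂).and (ne .dec₁ h₂)).and (((lt h₃).and (ne .dec₂ h₃)).and (lt h₄)))

theorem CounterData.valid_primrec : PrimrecPred CounterData.Valid := by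
  have len : Primrec (fun d : CounterData => d.1.length) := Primrec.list_length.comp Primrec.fst
  have hL := CounterRow.valid_primrec.forall_mem_list.comp (Primrec.fst (β := (ℕ × ℕ × ℕ) × ℕ)) len
  have hi := Primrec.nat_lt.comp (Primrec.fst.comp (Primrec.fst.comp
    (Primrec.snd (α := List CounterRow) (β := (ℕ × ℕ × ℕ) × ℕ)))) len
  have hq := Primrec.nat_lt.comp (Primrec.snd.comp
    (Primrec.snd (α := List CounterRow) (β := (ℕ × ℕ × ℕ) × ℕ))) len
  exact hL.and (hi.and hq)

open Classical in
/-- Algorithms on instances are algorithms on the data that describe them. -/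
noncomputable instance : Primcodable CounterInstance :=
  letI : Primcodable {d : CounterData // CounterData.Valid d} :=
    Primcodable.subtype CounterData.valid_primrec
  Primcodable.ofEquiv _ CounterInstance.equivData

/-! Minsky's reduction, followed by a diagonal argument. Contents `s` of the registers are stored in
the first counter as the product of the `p_i ^ s i`, where `p_i` is the `i`-th prime, while the
second counter is zero. Incrementing register `i` is multiplication by `p_i`; testing and
decrementing it is trial division by `p_i`; the second counter is workspace for both (`mul`,
`tryDiv`). Programs built from these by sequencing and looping compute every partial recursive
function (`RegisterComputable.of_partrec'`). Hence a partial recursive `f` yields instances `I n`,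
primitive recursive in `n`, such that whenever `f n` is defined, `I n` reaches its state iff `f n =
0` (`exists_simulation`).

Realizing a relation only means that related data are joined by a run. Determinism supplies the
converse where it is needed (`ofFlow_reaches`), and divergent computations play no role.

`withOnes` appends a clean-up phase that keeps the answer and leaves both counters at one. Suppose a
partial algorithm were correct on all instances with that property. Let `I n` simulate the `n`-th
code on input `n`, run the algorithm on `(I n).withOnes`, and output 1 for yes and 0 for no. At a
code of this very function the state is reached iff the output is 0, that is, iff the answer is no.
-/

/-! ### Flows: fragments of counter machines with exits. -/

/-- A finite control acting on two counters, with states `σ` and exits `E`. -/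
structure CounterFlow (σ E : Type) where
  Γ : σ → Bool → Bool → (σ ⊕ E) × CounterMove
  consistent₁ : ∀ i b, (Γ i false b).2 ≠ CounterMove.dec₁
  consistent₂ : ∀ i b, (Γ i b false).2 ≠ CounterMove.dec₂

namespace CounterFlow

variable {σ τ E E' : Type}

/-- One step of a flow; nothing happens after an exit. -/
inductive Step (F : CounterFlow σ E) : (σ ⊕ E) × ℕ × ℕ → (σ ⊕ E) × ℕ × ℕ → Prop
  | mk (i : σ) (c : ℕ × ℕ) :
      F.Step (Sum.inl i, c) ((F.Γ i (decide (0 < c.1)) (decide (0 < c.2))).1,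
        (F.Γ i (decide (0 < c.1)) (decide (0 < c.2))).2.apply c)

/-- Finitely many steps of a flow. -/
def Reach (F : CounterFlow σ E) : (σ ⊕ E) × ℕ × ℕ → (σ ⊕ E) × ℕ × ℕ → Prop :=
  Relation.ReflTransGen F.Step

/-- The gluing principle: `j` embeds the states into a larger flow, and `h` may redirect exits to
states there. -/
theorem Reach.lift {F : CounterFlow σ E} {G : CounterFlow τ E'} (j : σ → τ)
    (h : σ ⊕ E → τ ⊕ E') (hj : ∀ i, h (Sum.inl i) = Sum.inl (j i))
    (hΓ : ∀ i b b', G.Γ (j i) b b' = (h (F.Γ i b b').1, (F.Γ i b b').2))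
    {x y : σ ⊕ E} {c d : ℕ × ℕ} (hr : F.Reach (x, c) (y, d)) :
    G.Reach (h x, c) (h y, d) := by
  refine Relation.ReflTransGen.lift (fun s : (σ ⊕ E) × ℕ × ℕ => (h s.1, s.2)) ?_ _ _ hr
  rintro _ _ ⟨i, c⟩
  have := Step.mk (F := G) (j i) c
  rw [hΓ] at this
  simpa [Function.onFun, hj] using this

end CounterFlow

/-! ### Realizable relations and their control structures. -/

/-- The relation `R` between input counters, exit and output counters is realized by a flow. -/
def CounterRealizable {E : Type} (R : ℕ × ℕ → E → ℕ × ℕ → Prop) : Prop :=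
  ∃ (σ : Type) (_ : Finite σ) (F : CounterFlow σ E) (q : σ),
    ∀ c e c', R c e c' → F.Reach (Sum.inl q, c) (Sum.inr e, c')

/-- Iteration of a relation until it selects a proper exit. -/
inductive CounterIterate {E : Type} (R : ℕ × ℕ → Option E → ℕ × ℕ → Prop) :
    ℕ × ℕ → E → ℕ × ℕ → Prop
  | done {c e c'} : R c (some e) c' → CounterIterate R c e c'
  | step {c c₁ e c'} : R c none c₁ → CounterIterate R c₁ e c' → CounterIterate R c e c'

namespace CounterRealizable

variable {E E' : Type}

theorem mono {R S : ℕ × ℕ → E → ℕ × ℕ → Prop} (hR : CounterRealizable R)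
    (h : ∀ c e c', S c e c' → R c e c') : CounterRealizable S := by
  obtain ⟨σ, hσ, F, q, hF⟩ := hR
  exact ⟨σ, hσ, F, q, fun c e c' hs => hF c e c' (h c e c' hs)⟩

theorem act (f : Bool → Bool → E × CounterMove) (h₁ : ∀ b, (f false b).2 ≠ .dec₁)
    (h₂ : ∀ b, (f b false).2 ≠ .dec₂) :
    CounterRealizable fun c e c' => e = (f (decide (0 < c.1)) (decide (0 < c.2))).1 ∧
      c' = (f (decide (0 < c.1)) (decide (0 < c.2))).2.apply c := by
  refine ⟨Unit, inferInstance, ⟨fun _ b b' => (Sum.inr (f b b').1, (f b b').2),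
    fun _ => h₁, fun _ => h₂⟩, (), ?_⟩
  rintro c _ _ ⟨rfl, rfl⟩
  exact Relation.ReflTransGen.single (CounterFlow.Step.mk () c)

/-- Take the disjoint union of the first flow and one continuation per exit, and redirect exit `e`
to the start of the continuation for `e`. Finiteness of `E` keeps the state set finite. -/
theorem bind [Finite E] {R : ℕ × ℕ → E → ℕ × ℕ → Prop}
    {K : E → ℕ × ℕ → E' → ℕ × ℕ → Prop} (hR : CounterRealizable R)
    (hK : ∀ e, CounterRealizable (K e)) :
    CounterRealizable fun c e' c'' => ∃ e c', R c e c' ∧ K e c' e' c'' := by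
  obtain ⟨σ, hσ, F, q, hF⟩ := hR
  choose τ hτ G r hG using hK
  let h : σ ⊕ E → (σ ⊕ Σ e, τ e) ⊕ E' :=
    Sum.elim (fun i => .inl (.inl i)) fun e => .inl (.inr ⟨e, r e⟩)
  let k : ∀ e, τ e ⊕ E' → (σ ⊕ Σ e, τ e) ⊕ E' := fun e =>
    Sum.elim (fun i => .inl (.inr ⟨e, i⟩)) .inr
  let H : CounterFlow (σ ⊕ Σ e, τ e) E' :=
    ⟨fun i b b' => match i with
      | .inl i => (h (F.Γ i b b').1, (F.Γ i b b').2)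
      | .inr ⟨e, i⟩ => (k e ((G e).Γ i b b').1, ((G e).Γ i b b').2), by
      rintro (i | ⟨e, i⟩) b
      · exact F.consistent₁ i b
      · exact (G e).consistent₁ i b, by
      rintro (i | ⟨e, i⟩) b
      · exact F.consistent₂ i b
      · exact (G e).consistent₂ i b⟩
  refine ⟨σ ⊕ Σ e, τ e, inferInstance, H, .inl q, ?_⟩
  rintro c e' c'' ⟨e, c', h₁, h₂⟩
  have l₁ := CounterFlow.Reach.lift (G := H) Sum.inl h (fun _ => rfl) (fun _ _ _ => rfl)
    (hF _ _ _ h₁)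
  have l₂ := CounterFlow.Reach.lift (G := H) (fun i => Sum.inr ⟨e, i⟩) (k e) (fun _ => rfl)
    (fun _ _ _ => rfl) (hG e _ _ _ h₂)
  exact l₁.trans l₂

/-- Redirect the exit `none` back to the start state. -/
theorem iterate {R : ℕ × ℕ → Option E → ℕ × ℕ → Prop} (hR : CounterRealizable R) :
    CounterRealizable (CounterIterate R) := by
  obtain ⟨σ, hσ, F, q, hF⟩ := hR
  let h : σ ⊕ Option E → σ ⊕ E := fun x => match x with
    | .inl i => .inl i
    | .inr none => .inl q
    | .inr (some e) => .inr e
  let H : CounterFlow σ E := ⟨fun i b b' => (h (F.Γ i b b').1, (F.Γ i b b').2),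
    F.consistent₁, F.consistent₂⟩
  have lift : ∀ {x y : σ ⊕ Option E} {c d : ℕ × ℕ}, F.Reach (x, c) (y, d) →
      H.Reach (h x, c) (h y, d) := fun hr =>
    CounterFlow.Reach.lift (G := H) id h (fun _ => rfl) (fun _ _ _ => rfl) hr
  refine ⟨σ, hσ, H, q, fun c e c' hi => ?_⟩
  induction hi with
  | done h₁ => exact lift (hF _ _ _ h₁)
  | step h₁ _ ih => exact (lift (hF _ _ _ h₁)).trans ih

/-! ### Arithmetic with two counters. -/

theorem pure (e : E) : CounterRealizable fun c e' c' => e' = e ∧ c' = c :=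
  act (fun _ _ => (e, .stay)) (by simp) (by simp)

theorem incFst : CounterRealizable fun c (_ : Unit) c' => c' = (c.1 + 1, c.2) :=
  (act (fun _ _ => ((), .inc₁)) (by simp) (by simp)).mono fun _ _ _ h => ⟨rfl, h⟩

theorem incSnd : CounterRealizable fun c (_ : Unit) c' => c' = (c.1, c.2 + 1) :=
  (act (fun _ _ => ((), .inc₂)) (by simp) (by simp)).mono fun _ _ _ h => ⟨rfl, h⟩

theorem tryDecFst : CounterRealizable fun c (b : Bool) c' =>
    (b = true ∧ c = (c'.1 + 1, c'.2)) ∨ (b = false ∧ c.1 = 0 ∧ c' = c) := by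
  refine (act (fun b _ => (b, cond b .dec₁ .stay)) (by simp) (by rintro ⟨⟩ <;> simp)).mono ?_
  rintro ⟨a, b⟩ _ c' (⟨rfl, h⟩ | ⟨rfl, h, rfl⟩)
  · obtain ⟨rfl, rfl⟩ := Prod.mk.inj h
    simp [CounterMove.apply]
  · simp_all [CounterMove.apply]

theorem tryDecSnd : CounterRealizable fun c (b : Bool) c' =>
    (b = true ∧ c = (c'.1, c'.2 + 1)) ∨ (b = false ∧ c.2 = 0 ∧ c' = c) := by
  refine (act (fun _ b => (b, cond b .dec₂ .stay)) (by rintro ⟨⟩ <;> simp) (by simp)).mono ?_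
  rintro ⟨a, b⟩ _ c' (⟨rfl, h⟩ | ⟨rfl, h, rfl⟩)
  · obtain ⟨rfl, rfl⟩ := Prod.mk.inj h
    simp [CounterMove.apply]
  · simp_all [CounterMove.apply]

theorem branch {R : ℕ × ℕ → Bool → ℕ × ℕ → Prop} {S T : ℕ × ℕ → E → ℕ × ℕ → Prop}
    (hR : CounterRealizable R) (hS : CounterRealizable S) (hT : CounterRealizable T) :
    CounterRealizable fun c e c'' =>
      ∃ c', (R c true c' ∧ S c' e c'') ∨ (R c false c' ∧ T c' e c'') := by
  refine (bind (K := fun b => cond b S T) hR (by rintro (_ | _); exacts [hT, hS])).mono ?_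
  rintro c e c'' ⟨c', h | h⟩
  · exact ⟨true, c', h⟩
  · exact ⟨false, c', h⟩

theorem seq {R : ℕ × ℕ → Unit → ℕ × ℕ → Prop} {S : ℕ × ℕ → E → ℕ × ℕ → Prop}
    (hR : CounterRealizable R) (hS : CounterRealizable S) :
    CounterRealizable fun c e c'' => ∃ c', R c () c' ∧ S c' e c'' :=
  (bind hR fun _ => hS).mono fun _ _ _ ⟨c', h⟩ => ⟨(), c', h⟩

theorem addFst (r : ℕ) : CounterRealizable fun c (_ : Unit) c' => c' = (c.1 + r, c.2) := by
  induction r with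
  | zero => exact (pure ()).mono fun _ _ _ h => ⟨rfl, h⟩
  | succ r ih => exact (ih.seq incFst).mono fun c _ c' h => ⟨_, rfl, by rw [h]; rfl⟩

theorem addSnd (r : ℕ) : CounterRealizable fun c (_ : Unit) c' => c' = (c.1, c.2 + r) := by
  induction r with
  | zero => exact (pure ()).mono fun _ _ _ h => ⟨rfl, h⟩
  | succ r ih => exact (ih.seq incSnd).mono fun c _ c' h => ⟨_, rfl, by rw [h]; rfl⟩

/-- Loop: each unit taken from the first counter adds `p` to the second. -/
theorem transferFst (p : ℕ) :
    CounterRealizable fun c (_ : Unit) c' => c' = (0, c.2 + p * c.1) := by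
  have body : CounterRealizable fun c (x : Option Unit) c' =>
      (x = none ∧ c.1 ≠ 0 ∧ c' = (c.1 - 1, c.2 + p)) ∨ (x = some () ∧ c.1 = 0 ∧ c' = c) := by
    refine (tryDecFst.branch ((addSnd p).seq (pure none)) (pure (some ()))).mono ?_
    rintro ⟨a, b⟩ _ _ (⟨rfl, h, rfl⟩ | ⟨rfl, h, rfl⟩)
    · exact ⟨(a - 1, b), .inl ⟨.inl ⟨rfl, by simp at h ⊢; omega⟩, _, rfl, rfl, rfl⟩⟩
    · exact ⟨_, .inr ⟨.inr ⟨rfl, h, rfl⟩, rfl, rfl⟩⟩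
  refine body.iterate.mono ?_
  rintro ⟨a, b⟩ _ _ rfl
  induction a generalizing b with
  | zero => exact .done (.inr ⟨rfl, rfl, rfl⟩)
  | succ a ih =>
    refine .step (.inl ⟨rfl, by simp, rfl⟩) ?_
    have e : b + p * (a + 1) = b + p + p * a := by ring
    simpa [e] using ih (b + p)

theorem transferSnd (p : ℕ) :
    CounterRealizable fun c (_ : Unit) c' => c' = (c.1 + p * c.2, 0) := by
  have body : CounterRealizable fun c (x : Option Unit) c' =>
      (x = none ∧ c.2 ≠ 0 ∧ c' = (c.1 + p, c.2 - 1)) ∨ (x = some () ∧ c.2 = 0 ∧ c' = c) := by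
    refine (tryDecSnd.branch ((addFst p).seq (pure none)) (pure (some ()))).mono ?_
    rintro ⟨a, b⟩ _ _ (⟨rfl, h, rfl⟩ | ⟨rfl, h, rfl⟩)
    · exact ⟨(a, b - 1), .inl ⟨.inl ⟨rfl, by simp at h ⊢; omega⟩, _, rfl, rfl, rfl⟩⟩
    · exact ⟨_, .inr ⟨.inr ⟨rfl, h, rfl⟩, rfl, rfl⟩⟩
  refine body.iterate.mono ?_
  rintro ⟨a, b⟩ _ _ rfl
  induction b generalizing a with
  | zero => exact .done (.inr ⟨rfl, rfl, rfl⟩)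
  | succ b ih =>
    refine .step (.inl ⟨rfl, by simp, rfl⟩) ?_
    have e : a + p * (b + 1) = a + p + p * b := by ring
    simpa [e] using ih (a + p)

/-- Transfer with factor `p`, then back with factor 1. -/
theorem mul (p : ℕ) :
    CounterRealizable fun c (_ : Unit) c' => c.2 = 0 ∧ c' = (p * c.1, 0) := by
  refine ((transferFst p).seq (transferSnd 1)).mono ?_
  rintro ⟨a, _⟩ _ _ ⟨rfl, rfl⟩
  exact ⟨_, rfl, by simp⟩

/-- Subtract `p - j` from the first counter and count one in the second; if the first counter is
too small, combine the quotient `c.2` and the residue `c.1 + j` of a division by `p`. -/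
theorem divStep (p j d : ℕ) (h : j + d = p) :
    CounterRealizable fun c (x : Option Bool) c' =>
      (x = none ∧ c.1 + j = c'.1 + p ∧ c'.2 = c.2 + 1) ∨
      (x = some true ∧ c.1 + j = 0 ∧ 0 < p ∧ c' = (c.2, 0)) ∨
      (x = some false ∧ 0 < c.1 + j ∧ c.1 + j < p ∧ c' = (c.1 + j + p * c.2, 0)) := by
  -- In this round `j` units are already gone and `d` remain, so `c.1 + j` is the value at the start
  -- of the round.
  induction d generalizing j with
  | zero =>
    refine (incSnd.seq (pure none)).mono ?_
    rintro ⟨a, b⟩ x ⟨a', b'⟩ h'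
    simp only at h'
    refine ⟨_, rfl, ?_, ?_⟩
    · rcases h' with h' | h' | h'
      · exact h'.1
      all_goals omega
    · rcases h' with h' | h' | h'
      · exact Prod.ext (by simp; omega) h'.2.2
      all_goals omega
  | succ d ih =>
    -- Reached when the first counter is empty. If `j = 0` the division was exact and factor 1
    -- returns the quotient; otherwise factor `p` and the residue `j` rebuild the dividend.
    have leaf : CounterRealizable fun c (x : Option Bool) c' =>
        ∃ c₁, c₁ = (c.1 + (if j = 0 then 1 else p) * c.2, 0) ∧
          ∃ c₂ : ℕ × ℕ, c₂ = (c₁.1 + j, c₁.2) ∧ x = some (decide (j = 0)) ∧ c' = c₂ :=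
      (transferSnd _).seq ((addFst j).seq (pure _))
    have next := ih (j + 1) (by omega)
    refine (tryDecFst.branch next leaf).mono ?_
    rintro ⟨a, b⟩ x ⟨a', b'⟩ h'
    simp only [Prod.mk.injEq] at h'
    rcases Nat.eq_zero_or_pos a with rfl | ha
    · refine ⟨(0, b), .inr ⟨.inr ⟨rfl, rfl, rfl⟩, _, rfl, _, rfl, ?_⟩⟩
      rcases h' with h' | h' | h'
      · omega
      · have hj : j = 0 := by omega
        simp [hj, h']
      · have hj : j ≠ 0 := by omega
        simp [hj, h', add_comm]
    · refine ⟨(a - 1, b), .inl ⟨.inl ⟨rfl, by simp; omega⟩, ?_⟩⟩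
      have e : a - 1 + (j + 1) = a + j := by omega
      simpa only [e, Prod.mk.injEq] using h'

/-- Division by `p` if it is exact; otherwise nothing changes. -/
theorem tryDiv (p : ℕ) (hp : 0 < p) : CounterRealizable fun c (b : Bool) c' =>
    (b = true ∧ c.2 = 0 ∧ c'.2 = 0 ∧ c.1 = p * c'.1) ∨
    (b = false ∧ c.2 = 0 ∧ c' = c ∧ ¬ p ∣ c.1) := by
  have key := (divStep p 0 p (by omega)).iterate
  refine key.mono ?_
  rintro ⟨a, b⟩ x ⟨a', b'⟩ (⟨rfl, h₁, h₂, h₃⟩ | ⟨rfl, h₁, h₂, h₃⟩)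
  · simp only at h₁ h₂ h₃
    subst h₁ h₂ h₃
    -- Here `n` multiples of `p` are still to be removed and `m` have been counted.
    suffices ∀ n m, n + m = a' → CounterIterate _ (p * n, m) true (a', 0) from this a' 0 rfl
    intro n
    induction n with
    | zero => rintro m rfl; exact .done (.inr (.inl ⟨rfl, rfl, hp, by simp⟩))
    | succ n ih =>
      intro m hm
      exact .step (.inl ⟨rfl, by simp only; ring, rfl⟩) (ih (m + 1) (by omega))
  · simp only at h₁ h₃
    obtain ⟨rfl, rfl⟩ := Prod.mk.inj h₂
    subst h₁
    have hr : 0 < a' % p := Nat.pos_of_ne_zero fun h => h₃ (Nat.dvd_of_mod_eq_zero h)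
    suffices ∀ n m, n + m = a' / p → CounterIterate _ (p * n + a' % p, m) false (a', 0) by
      have := this (a' / p) 0 rfl
      rwa [Nat.div_add_mod] at this
    intro n
    induction n with
    | zero =>
      rintro m hm
      refine .done (.inr (.inr ⟨rfl, by simpa using hr, by simpa using Nat.mod_lt _ hp, ?_⟩))
      have := Nat.div_add_mod a' p
      rw [← hm, zero_add] at this
      simp only [Prod.mk.injEq, and_true]
      omega
    | succ n ih =>
      intro m hm
      exact .step (.inl ⟨rfl, by simp only; ring, rfl⟩) (ih (m + 1) (by omega))

end CounterRealizable

/-! ### Gödel numbering of registers. -/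

/-- Contents of registers indexed by `ℕ`, almost all of them zero. -/
abbrev Registers := ℕ →₀ ℕ

namespace Registers

/-- The Gödel number of the contents of the registers. -/
noncomputable def code (s : Registers) : ℕ :=
  s.prod fun i a => Nat.nth Nat.Prime i ^ a

theorem code_add_single (s : Registers) (r : ℕ) :
    code (s + Finsupp.single r 1) = Nat.nth Nat.Prime r * code s := by
  unfold code
  rw [Finsupp.prod_add_index' (by simp) (by intros; rw [pow_add]), Finsupp.prod_single_index (by simp),
    pow_one, mul_comm]

theorem code_single (r n : ℕ) : code (Finsupp.single r n) = Nat.nth Nat.Prime r ^ n :=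
  Finsupp.prod_single_index (by simp)

/-- A prime dividing a product of prime powers is one of the bases. This makes failed division a
zero test. -/
theorem not_dvd_code {s : Registers} {r : ℕ} (h : s r = 0) : ¬ Nat.nth Nat.Prime r ∣ code s := by
  refine (Nat.prime_nth_prime r).prime.not_dvd_finsuppProd fun i hi hd => ?_
  have := (Nat.prime_dvd_prime_iff_eq (Nat.prime_nth_prime r) (Nat.prime_nth_prime i)).1
    ((Nat.prime_nth_prime r).dvd_of_dvd_pow hd)
  obtain rfl := Nat.nth_injective Nat.infinite_setOfPred_prime this
  simp [h] at hi

end Registers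

/-! ### Register programs. -/

open Registers in
/-- A relation between register contents, an exit and new contents is realized by a flow acting on
the Gödel number of the registers. -/
def RegisterTest {E : Type} (R : Registers → E → Registers → Prop) : Prop :=
  CounterRealizable fun c e c' => ∃ s s', R s e s' ∧ c = (code s, 0) ∧ c' = (code s', 0)

/-- A relation between contents of registers is realized by a flow with a single exit. -/
def RegisterProgram (R : Registers → Registers → Prop) : Prop :=
  RegisterTest fun s (_ : Unit) s' => R s s'

theorem RegisterTest.tryDec (r : ℕ) : RegisterTest fun s (b : Bool) s' =>
    (b = true ∧ s = s' + Finsupp.single r 1) ∨ (b = false ∧ s r = 0 ∧ s' = s) := by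
  refine (CounterRealizable.tryDiv _ (Nat.prime_nth_prime r).pos).mono ?_
  rintro _ _ _ ⟨s, s', ⟨rfl, rfl⟩ | ⟨rfl, h, rfl⟩, rfl, rfl⟩
  · exact .inl ⟨rfl, rfl, rfl, Registers.code_add_single s' r⟩
  · exact .inr ⟨rfl, rfl, rfl, Registers.not_dvd_code h⟩

/-- Repeat `R` until the register `r`, decremented before each round, is zero. -/
inductive RegisterLoop (r : ℕ) (R : Registers → Registers → Prop) : Registers → Registers → Prop
  | done {s} : s r = 0 → RegisterLoop r R s s
  | step {s s₁ s'} : R s s₁ → RegisterLoop r R s₁ s' →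
      RegisterLoop r R (s + Finsupp.single r 1) s'

namespace RegisterProgram

open Finsupp

variable {R S : Registers → Registers → Prop}

theorem mono (hR : RegisterProgram R) (h : ∀ s s', S s s' → R s s') : RegisterProgram S :=
  CounterRealizable.mono hR fun _ _ _ ⟨s, s', hs, hc⟩ => ⟨s, s', h s s' hs, hc⟩

theorem skip : RegisterProgram fun s s' => s' = s :=
  (CounterRealizable.pure ()).mono (by rintro _ _ _ ⟨s, _, rfl, rfl, rfl⟩; exact ⟨rfl, rfl⟩)

theorem inc (r : ℕ) : RegisterProgram fun s s' => s' = s + single r 1 :=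
  (CounterRealizable.mul (Nat.nth Nat.Prime r)).mono (by
    rintro _ _ _ ⟨s, _, rfl, rfl, rfl⟩
    exact ⟨rfl, by rw [Registers.code_add_single]⟩)

theorem test {E : Type} {T : Registers → E → Registers → Prop} (hR : RegisterProgram R)
    (hT : RegisterTest T) : RegisterTest fun s e s'' => ∃ s', R s s' ∧ T s' e s'' := by
  refine (CounterRealizable.seq hR hT).mono ?_
  rintro _ e _ ⟨s, s'', ⟨s', h, h'⟩, rfl, rfl⟩
  exact ⟨_, ⟨s, s', h, rfl, rfl⟩, s', s'', h', rfl, rfl⟩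

theorem seq (hR : RegisterProgram R) (hS : RegisterProgram S) :
    RegisterProgram fun s s'' => ∃ s', R s s' ∧ S s' s'' :=
  hR.test hS

theorem loop (r : ℕ) (hR : RegisterProgram R) : RegisterProgram (RegisterLoop r R) := by
  refine ((CounterRealizable.branch (RegisterTest.tryDec r)
    (CounterRealizable.seq hR (CounterRealizable.pure none))
    (CounterRealizable.pure (some ()))).iterate).mono ?_
  rintro _ _ _ ⟨s, s', h, rfl, rfl⟩
  induction h with
  | done h => exact .done ⟨_, .inr ⟨⟨_, _, .inr ⟨rfl, h, rfl⟩, rfl, rfl⟩, rfl, rfl⟩⟩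
  | step h _ ih =>
    exact .step ⟨_, .inl ⟨⟨_, _, .inl ⟨rfl, rfl⟩, rfl, rfl⟩, _, ⟨_, _, h, rfl, rfl⟩, rfl, rfl⟩⟩ ih

/-- Loop with empty body. The input is written as a sum so that `RegisterLoop.step` can peel off one
unit at a time. -/
theorem clear (r : ℕ) : RegisterProgram fun s s' => s' r = 0 ∧ ∃ a, s = s' + single r a := by
  refine (loop r skip).mono ?_
  rintro _ s ⟨hs, a, rfl⟩
  induction a with
  | zero => simpa using .done hs
  | succ a ih =>
    rw [single_add, ← add_assoc]
    exact .step rfl ih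

/-- Move the contents of the register `r` to two others. -/
theorem fork (r o k : ℕ) (ho : o ≠ r) (hk : k ≠ r) : RegisterProgram fun s s' =>
    ∃ t a, t r = 0 ∧ s = t + single r a ∧ s' = t + single o a + single k a := by
  refine (loop r ((inc o).seq (inc k))).mono ?_
  rintro _ _ ⟨t, a, ht, rfl, rfl⟩
  induction a generalizing t with
  | zero => simpa using .done ht
  | succ a ih =>
    have := ih (t + single o 1 + single k 1) (by simp [ht, ho, hk])
    rw [single_add, ← add_assoc]
    refine .step ⟨_, rfl, rfl⟩ ?_
    convert this using 1
    · abel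
    · simp only [single_add]; abel

theorem move (r o : ℕ) (ho : o ≠ r) : RegisterProgram fun s s' =>
    ∃ t a, t r = 0 ∧ s = t + single r a ∧ s' = t + single o a := by
  refine (loop r (inc o)).mono ?_
  rintro _ _ ⟨t, a, ht, rfl, rfl⟩
  induction a generalizing t with
  | zero => simpa using .done ht
  | succ a ih =>
    have := ih (t + single o 1) (by simp [ht, ho])
    rw [single_add, ← add_assoc]
    refine .step rfl ?_
    convert this using 1
    · abel
    · simp only [single_add]; abel

/-- Add the register `r` to the register `o`, using the scratch register `k`. -/
theorem copy (r o k : ℕ) (ho : o ≠ r) (hk : k ≠ r) (hok : o ≠ k) : RegisterProgram fun s s' =>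
    s k = 0 ∧ s' = s + single o (s r) := by
  -- Split `r` into `o` and `k`, then move `k` back to `r`.
  refine ((fork r o k ho hk).seq (move k r hk.symm)).mono ?_
  rintro s _ ⟨hs, rfl⟩
  have e := erase_add_single r s
  refine ⟨_, ⟨s.erase r, s r, by simp, e.symm, rfl⟩, s.erase r + single o (s r), s r, ?_, rfl, ?_⟩
  · simp [hk, hok, hs]
  · conv_lhs => rw [← e]
    simp only [Finsupp.add_apply, erase_same, single_eq_same, zero_add]
    abel

end RegisterProgram

/-! ### Register programs for partial recursive functions. -/

/-- The registers from `k` on are zero. -/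
def Registers.Below (s : Registers) (k : ℕ) : Prop := ∀ j, k ≤ j → s j = 0

/-- The function `f` is computed by register programs which add its value to an output register,
leave the input registers as they are and clean up all scratch registers. -/
def RegisterComputable {n : ℕ} (f : List.Vector ℕ n →. ℕ) : Prop :=
  ∀ (k : ℕ) (ρ : Fin n → ℕ) (o : ℕ), (∀ i, ρ i < k) → o < k → (∀ i, ρ i ≠ o) →
    RegisterProgram fun s s' => s.Below k ∧
      ∃ a ∈ f (List.Vector.ofFn fun i => s (ρ i)), s' = s + Finsupp.single o a

/-- The numbers `b 0, …, b (m - 1)` in the registers from `k` on. -/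
noncomputable def Registers.block (k : ℕ) (b : ℕ → ℕ) (m : ℕ) : Registers :=
  ∑ j ∈ Finset.range m, Finsupp.single (k + j) (b j)

theorem Registers.block_succ (k : ℕ) (b : ℕ → ℕ) (m : ℕ) :
    block k b (m + 1) = block k b m + Finsupp.single (k + m) (b m) :=
  Finset.sum_range_succ _ _

theorem Registers.block_apply (k : ℕ) (b : ℕ → ℕ) (m x : ℕ) :
    block k b m x = if k ≤ x ∧ x < k + m then b (x - k) else 0 := by
  induction m with
  | zero => simp [block]
  | succ m ih =>
    rw [block_succ, Finsupp.add_apply, ih, Finsupp.single_apply]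
    rcases eq_or_ne (k + m) x with rfl | h
    · simp
    · simp only [h, if_false, add_zero]
      congr 1
      simp only [eq_iff_iff]
      omega

theorem List.Vector.mem_mOfFn {α : Type*} {n : ℕ} {g : Fin n → Part α} {w : List.Vector α n}
    (h : w ∈ List.Vector.mOfFn g) (i : Fin n) : w.get i ∈ g i := by
  induction n with
  | zero => exact i.elim0
  | succ n ih =>
    simp only [List.Vector.mOfFn, Part.bind_eq_bind, Part.pure_eq_some, Part.mem_bind_iff, Part.mem_some_iff] at h
    obtain ⟨a, ha, v, hv, rfl⟩ := h
    refine Fin.cases ?_ (fun j => ?_) i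
    · simpa using ha
    · simpa using ih hv j

namespace RegisterComputable

open Finsupp Registers

theorem of_mem {n : ℕ} {f g : List.Vector ℕ n →. ℕ} (hf : RegisterComputable f)
    (h : ∀ v, ∀ a ∈ g v, a ∈ f v) : RegisterComputable g := fun k ρ o hρ ho hne =>
  (hf k ρ o hρ ho hne).mono fun _ _ ⟨hs, a, ha, e⟩ => ⟨hs, a, h _ a ha, e⟩

theorem clearBlock (k m : ℕ) : RegisterProgram fun s s' =>
    ∃ b, s = s' + block k b m ∧ ∀ j < m, s' (k + j) = 0 := by
  induction m with
  | zero => exact RegisterProgram.skip.mono fun s s' ⟨b, h, _⟩ => by simpa [block] using h.symm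
  | succ m ih =>
    refine ((RegisterProgram.clear (k + m)).seq ih).mono ?_
    rintro _ s ⟨b, rfl, h⟩
    refine ⟨s + block k b m, ⟨?_, b m, ?_⟩, b, rfl, fun j hj => h j (by omega)⟩
    · simp [block_apply, h m (by omega)]
    · rw [block_succ, add_assoc]

/-- Value number `i` goes to register `k + i`; scratch space starts at `k + m`, so earlier results
are safe. -/
theorem evalBlock {n m : ℕ} {g : Fin m → List.Vector ℕ n →. ℕ}
    (hg : ∀ i, RegisterComputable (g i)) (k : ℕ) (ρ : Fin n → ℕ) (hρ : ∀ i, ρ i < k) (l : ℕ)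
    (hl : l ≤ m) : RegisterProgram fun s s' => s.Below k ∧
      ∃ b : ℕ → ℕ, (∀ i : Fin m, b i ∈ g i (List.Vector.ofFn fun i => s (ρ i))) ∧
        s' = s + block k b l := by
  induction l with
  | zero =>
    exact RegisterProgram.skip.mono fun s s' ⟨_, b, _, h⟩ => by simpa [block] using h
  | succ l ih =>
    refine ((ih (by omega)).seq (hg ⟨l, hl⟩ (k + m) ρ (k + l) (fun i => (hρ i).trans_le (by omega))
      (by omega) fun i => by have := hρ i; omega)).mono ?_
    rintro s _ ⟨hs, b, hb, rfl⟩
    refine ⟨_, ⟨hs, b, hb, rfl⟩, fun j hj => ?_, b l, ?_, ?_⟩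
    · have := hs j (by omega)
      simp only [Finsupp.add_apply, this, block_apply, zero_add]
      rw [if_neg (by omega)]
    · convert hb ⟨l, hl⟩ using 4 with i
      have := hρ i
      simp only [Finsupp.add_apply, block_apply]
      rw [if_neg (by omega), add_zero]
    · rw [block_succ, add_assoc]

/-- Store the inner values in a block, apply `f` to the block with scratch space beyond it, then
clear the block. -/
theorem comp {n m : ℕ} {f : List.Vector ℕ m →. ℕ} {g : Fin m → List.Vector ℕ n →. ℕ}
    (hf : RegisterComputable f) (hg : ∀ i, RegisterComputable (g i)) :
    RegisterComputable fun v => (List.Vector.mOfFn fun i => g i v) >>= f := by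
  intro k ρ o hρ ho hne
  refine ((evalBlock hg k ρ hρ m le_rfl).seq ((hf (k + m) (fun i => k + i) o (fun i => by omega)
    (by omega) fun i => by omega).seq (clearBlock k m))).mono ?_
  rintro s _ ⟨hs, a, ha, rfl⟩
  obtain ⟨w, hw, ha⟩ := Part.mem_bind_iff.1 ha
  have hw := List.Vector.mem_mOfFn hw
  let b : ℕ → ℕ := fun j => if h : j < m then w.get ⟨j, h⟩ else 0
  refine ⟨_, ⟨hs, b, fun i => by simpa [b] using hw i, rfl⟩, _, ⟨fun j hj => ?_, a, ?_, rfl⟩,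
    b, ?_, fun j hj => ?_⟩
  · have := hs j (by omega)
    simp only [Finsupp.add_apply, this, block_apply, zero_add]
    rw [if_neg (by omega)]
  · convert ha
    apply List.Vector.ext
    intro i
    have := hs (k + i) (by omega)
    simp [block_apply, b, this]
  · abel
  · simp [hs (k + j) (by omega), show o ≠ k + j by omega]

theorem zero : RegisterComputable (n := 0) fun _ => Part.some 0 := fun k ρ o _ _ _ =>
  RegisterProgram.skip.mono (by rintro s _ ⟨_, a, ha, rfl⟩; simp_all)

theorem get {n : ℕ} (i : Fin n) : RegisterComputable fun v => Part.some (v.get i) := by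
  intro k ρ o hρ ho hne
  refine (RegisterProgram.copy (ρ i) o k (hne i).symm (hρ i).ne' ho.ne).mono ?_
  rintro s _ ⟨hs, a, ha, rfl⟩
  exact ⟨hs k le_rfl, by simp_all⟩

theorem succ : RegisterComputable (n := 1) fun v => Part.some (v.head + 1) := by
  intro k ρ o hρ ho hne
  refine ((get 0 k ρ o hρ ho hne).seq (RegisterProgram.inc o)).mono ?_
  rintro s _ ⟨hs, a, ha, rfl⟩
  refine ⟨_, ⟨hs, _, Part.mem_some _, rfl⟩, ?_⟩
  obtain rfl := Part.mem_some_iff.1 ha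
  rw [add_assoc, ← single_add]
  simp [List.Vector.ofFn]

theorem prec {n : ℕ} {f : List.Vector ℕ n → ℕ} {g : List.Vector ℕ (n + 2) → ℕ}
    (hf : RegisterComputable fun v => Part.some (f v))
    (hg : RegisterComputable fun v => Part.some (g v)) :
    RegisterComputable fun v : List.Vector ℕ (n + 1) =>
      Part.some (v.head.rec (f v.tail) fun y IH => g (y ::ᵥ IH ::ᵥ v.tail)) := by
  intro k ρ o hρ ho hne
  have hρ' : ∀ i : Fin n, ρ i.succ < k := fun i => hρ _
  let V : Registers → List.Vector ℕ n := fun s => List.Vector.ofFn fun i => s (ρ i.succ)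
  let F : Registers → ℕ → ℕ := fun s y => y.rec (f (V s)) fun y IH => g (y ::ᵥ IH ::ᵥ V s)
  -- One round. Register `k` holds the rounds left, `k + 1` the index, `k + 2` the current value, `k
  -- + 3` the next one; scratch starts at `k + 4`. The bound on `u` is `k + 1` because `u` includes
  -- the round counter.
  let B : Registers → Registers → Prop := fun s s' => ∃ u i x, u.Below (k + 1) ∧
    s = u + single (k + 1) i + single (k + 2) x ∧
    s' = u + single (k + 1) (i + 1) + single (k + 2) (g (i ::ᵥ x ::ᵥ V u))
  have body : RegisterProgram B := by
    refine ((hg (k + 4) (Fin.cons (k + 1) (Fin.cons (k + 2) fun i => ρ i.succ)) (k + 3) ?_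
      (by omega) ?_).seq ((RegisterProgram.clear (k + 2)).seq
      ((RegisterProgram.move (k + 3) (k + 2) (by omega)).seq
      (RegisterProgram.inc (k + 1))))).mono ?_
    · refine Fin.cases (by simp) (Fin.cases (by simp) fun i => ?_)
      have := hρ' i
      simp only [Fin.cons_succ]; omega
    · refine Fin.cases (by simp) (Fin.cases (by simp) fun i => ?_)
      have := hρ' i
      simp only [Fin.cons_succ]; omega
    · rintro _ _ ⟨u, i, x, hu, rfl, rfl⟩
      have h₁ := hu (k + 1) (by omega)
      have h₂ := hu (k + 2) (by omega)
      have h₃ := hu (k + 3) (by omega)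
      refine ⟨_, ⟨fun j hj => ?_, g (i ::ᵥ x ::ᵥ V u), ?_, rfl⟩,
        u + single (k + 1) i + single (k + 3) (g (i ::ᵥ x ::ᵥ V u)), ⟨?_, x, by abel⟩,
        u + single (k + 1) i + single (k + 2) (g (i ::ᵥ x ::ᵥ V u)),
        ⟨u + single (k + 1) i, _, ?_, rfl, rfl⟩, ?_⟩
      · simp [hu j (by omega), show k + 1 ≠ j by omega, show k + 2 ≠ j by omega]
      · rw [Part.mem_some_iff]
        congr 1
        apply List.Vector.ext
        refine Fin.cases ?_ (Fin.cases ?_ fun j => ?_)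
        · simp [h₁]
        · simp [h₂]; rfl
        · have := hρ' j
          simp [V, single_apply, show k + 1 ≠ ρ j.succ by omega,
            show k + 2 ≠ ρ j.succ by omega]
      · simp [h₂]
      · simp [h₃]
      · rw [single_add]; abel
  have loop : ∀ (u : Registers) (m i : ℕ), u.Below k → RegisterLoop k B
      (u + single (k + 1) i + single (k + 2) (F u i) + single k m)
      (u + single (k + 1) (i + m) + single (k + 2) (F u (i + m))) := by
    intro u m
    induction m with
    | zero => exact fun i hu => by simpa using .done (by simp [hu k le_rfl])
    | succ m ih =>
      intro i hu
      rw [single_add, ← add_assoc]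
      refine .step (s₁ := u + single (k + 1) (i + 1) + single (k + 2) (F u (i + 1)) + single k m)
        ⟨u + single k m, i, F u i, fun j hj => ?_, by abel, ?_⟩ ?_
      · simp [hu j (by omega), show k ≠ j by omega]
      · have : V (u + single k m) = V u := by
          apply List.Vector.ext
          intro j
          have := hρ' j
          simp [V, single_apply, show k ≠ ρ j.succ by omega]
        rw [this]
        simp only [F]
        abel
      · have := ih (i + 1) hu
        rwa [show i + 1 + m = i + (m + 1) by omega] at this
  refine ((RegisterProgram.copy (ρ 0) k (k + 4) (hρ 0).ne' (by have := hρ 0; omega)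
    (by omega)).seq ((hf (k + 4) (fun i => ρ i.succ) (k + 2) (fun i => (hρ' i).trans (by omega))
      (by omega) fun i => by have := hρ' i; omega).seq ((RegisterProgram.loop k body).seq
      ((RegisterProgram.move (k + 2) o (by omega)).seq (RegisterProgram.clear (k + 1)))))).mono ?_
  rintro s _ ⟨hs, a, ha, rfl⟩
  have hs₁ := hs (k + 1) (by omega)
  have hs₂ := hs (k + 2) (by omega)
  have ha : a = F s (s (ρ 0)) := by
    rw [Part.mem_some_iff] at ha
    simpa [F, V, List.Vector.ofFn] using ha
  subst ha
  refine ⟨_, ⟨hs _ (by omega), rfl⟩, _, ⟨fun j hj => ?_, f (V s), ?_, rfl⟩,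
    s + single (k + 1) (s (ρ 0)) + single (k + 2) (F s (s (ρ 0))), ?_,
    s + single (k + 1) (s (ρ 0)) + single o (F s (s (ρ 0))),
    ⟨s + single (k + 1) (s (ρ 0)), _, ?_, rfl, rfl⟩, ?_, s (ρ 0), by abel⟩
  · simp [hs j (by omega), show k ≠ j by omega]
  · rw [Part.mem_some_iff]
    congr 1
    apply List.Vector.ext
    intro j
    have := hρ' j
    simp [V, single_apply, show k ≠ ρ j.succ by omega]
  · have := loop s (s (ρ 0)) 0 hs
    rw [zero_add] at this
    convert this using 1
    rw [single_zero, add_zero]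
    exact add_right_comm _ _ _
  · simp [hs₂]
  · simp [hs₁, show o ≠ k + 1 by omega]

/-- Register `k` holds the candidate and `k + 1` its value under `f`; looping on `k + 1` passes to
the next candidate as long as the value is nonzero. -/
theorem rfind {n : ℕ} {f : List.Vector ℕ (n + 1) → ℕ}
    (hf : RegisterComputable fun v => Part.some (f v)) :
    RegisterComputable fun v => Nat.rfind fun y => Part.some (f (y ::ᵥ v) = 0) := by
  intro k ρ o hρ ho hne
  let V : Registers → List.Vector ℕ n := fun s => List.Vector.ofFn fun i => s (ρ i)
  have eval : RegisterProgram fun s s' => ∃ u i, u.Below k ∧ s = u + single k i ∧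
      s' = u + single k i + single (k + 1) (f (i ::ᵥ V u)) := by
    refine (hf (k + 2) (Fin.cons k ρ) (k + 1) ?_ (by omega) ?_).mono ?_
    · refine Fin.cases (by simp) fun i => ?_
      have := hρ i
      simp only [Fin.cons_succ]; omega
    · refine Fin.cases (by simp) fun i => ?_
      have := hρ i
      simp only [Fin.cons_succ]; omega
    · rintro _ _ ⟨u, i, hu, rfl, rfl⟩
      refine ⟨fun j hj => ?_, _, ?_, rfl⟩
      · simp [hu j (by omega), show k ≠ j by omega]
      · rw [Part.mem_some_iff]
        congr 1
        apply List.Vector.ext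
        refine Fin.cases ?_ fun j => ?_
        · simp [hu k le_rfl]
        · have := hρ j
          simp [V, single_apply, show k ≠ ρ j by omega]
  -- Induction on the distance `m` from the candidate `i` to the least zero.
  have loop : ∀ (u : Registers) (m i : ℕ), u.Below k → f ((i + m) ::ᵥ V u) = 0 →
      (∀ j, i ≤ j → j < i + m → f (j ::ᵥ V u) ≠ 0) →
      RegisterLoop (k + 1) (fun s s' => ∃ s₁, (s₁ (k + 1) = 0 ∧ ∃ a, s = s₁ + single (k + 1) a) ∧
        ∃ s₂, s₂ = s₁ + single k 1 ∧ ∃ u i, u.Below k ∧ s₂ = u + single k i ∧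
          s' = u + single k i + single (k + 1) (f (i ::ᵥ V u)))
        (u + single k i + single (k + 1) (f (i ::ᵥ V u))) (u + single k (i + m)) := by
    intro u m
    induction m with
    | zero =>
      intro i hu h _
      rw [add_zero] at h ⊢
      simpa [h] using .done (by simp [hu (k + 1) (by omega)])
    | succ m ih =>
      intro i hu h h'
      -- The loop test removes one unit of the nonzero value; the other `z` are cleared by the body.
      obtain ⟨z, hz⟩ := Nat.exists_eq_succ_of_ne_zero (h' i le_rfl (by omega))
      rw [hz, Nat.succ_eq_add_one, single_add, ← add_assoc]
      refine .step ⟨u + single k i, ⟨by simp [hu (k + 1) (by omega)], z, rfl⟩, _, rfl, u, i + 1, hu,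
        by rw [single_add, add_assoc], rfl⟩ ?_
      have e : i + 1 + m = i + (m + 1) := by omega
      have := ih (i + 1) hu (by rwa [e]) fun j hj hj' => h' j (by omega) (by omega)
      rwa [e] at this
  refine (eval.seq ((RegisterProgram.loop (k + 1) ((RegisterProgram.clear (k + 1)).seq
    ((RegisterProgram.inc k).seq eval))).seq (RegisterProgram.move k o ho.ne))).mono ?_
  rintro s _ ⟨hs, a, ha, rfl⟩
  replace ha := Nat.mem_rfind.1 ha
  refine ⟨_, ⟨s, 0, hs, by simp, rfl⟩, _, loop s a 0 hs ?_ ?_, s, a, hs k le_rfl, by simp, rfl⟩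
  · simpa using ha.1
  · intro j _ hj
    have := ha.2 (m := j) (by omega)
    simpa using this

theorem of_primrec' {n : ℕ} {f : List.Vector ℕ n → ℕ} (hf : Nat.Primrec' f) :
    RegisterComputable fun v => Part.some (f v) := by
  induction hf with
  | zero => exact zero
  | succ => exact succ
  | get i => exact get i
  | comp g _ _ hf hg =>
    refine (comp hf hg).of_mem fun v a ha => ?_
    have := List.Vector.mOfFn_pure (m := Part) fun i => g i v
    simp only [Part.pure_eq_some] at this
    rw [this]
    simpa using ha
  | prec _ _ hf hg => exact prec hf hg

/-- `Nat.Partrec'` minimizes total functions only, so `rfind` for total `f` is enough. -/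
theorem of_partrec' {n : ℕ} {f : List.Vector ℕ n →. ℕ} (hf : Nat.Partrec' f) :
    RegisterComputable f := by
  induction hf with
  | prim hf => exact of_primrec' hf
  | comp g _ _ hf hg => exact comp hf hg
  | rfind _ hf => exact rfind hf

end RegisterComputable

/-! ### Effective construction of instances. -/

namespace CounterInstance

theorem toData_primrec : Primrec toData := by
  classical
  let : Primcodable {d : CounterData // CounterData.Valid d} :=
    Primcodable.subtype CounterData.valid_primrec
  have h : Primrec equivData := Primrec.of_equiv
  have h' : Primrec (Subtype.val : {d : CounterData // CounterData.Valid d} → CounterData) :=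
    Primrec.subtype_val
  exact h'.comp h

/-- The coding of instances is transported from their data, so it is enough to check the data. -/
theorem primrec_of_toData {α : Type*} [Primcodable α] {f : α → CounterInstance}
    (hf : Primrec fun a => (f a).toData) : Primrec f := by
  classical
  let : Primcodable {d : CounterData // CounterData.Valid d} :=
    Primcodable.subtype CounterData.valid_primrec
  have h : Primrec fun a => equivData (f a) := Primrec.subtype_val_iff.1 hf
  exact (Primrec.of_equiv_iff equivData).1 h

/-! ### Instances from flows -/

section Flow

variable {σ : Type} {m : ℕ}

/-- The counter machine of a flow, which stops moving at the exits. -/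
def ofFlowMachine (F : CounterFlow σ Bool) (e : σ ⊕ Bool ≃ Fin m) : CounterMachine m where
  Γ i b b' := match e.symm i with
    | .inl i => (e (F.Γ i b b').1, (F.Γ i b b').2)
    | .inr x => (e (.inr x), .stay)
  consistent₁ i b := by
    rcases e.symm i with i | x
    · exact F.consistent₁ i b
    · simp
  consistent₂ i b := by
    rcases e.symm i with i | x
    · exact F.consistent₂ i b
    · simp

variable (F : CounterFlow σ Bool) (e : σ ⊕ Bool ≃ Fin m)

theorem ofFlowMachine_step {s s' : (σ ⊕ Bool) × ℕ × ℕ} (h : F.Step s s') :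
    (ofFlowMachine F e).step (e s.1, s.2) = (e s'.1, s'.2) := by
  obtain ⟨i, c⟩ := h
  simp [CounterMachine.step, ofFlowMachine]

theorem ofFlowMachine_config {s s' : (σ ⊕ Bool) × ℕ × ℕ} (h : F.Reach s s') :
    ∃ t, (ofFlowMachine F e).config (e s.1, s.2) t = (e s'.1, s'.2) := by
  induction h with
  | refl => exact ⟨0, rfl⟩
  | tail _ h ih =>
    obtain ⟨t, ht⟩ := ih
    refine ⟨t + 1, ?_⟩
    rw [CounterMachine.config, Function.iterate_succ_apply', ← CounterMachine.config, ht,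
      ofFlowMachine_step F e h]

theorem ofFlowMachine_iterate_exit (x : Bool) (c : ℕ × ℕ) (t : ℕ) :
    (ofFlowMachine F e).step^[t] (e (.inr x), c) = (e (.inr x), c) :=
  Function.iterate_fixed (by simp [CounterMachine.step, ofFlowMachine, CounterMove.apply]) t

/-- The instance that starts a flow in a given state and asks for the exit `false`. -/
def ofFlow (q : σ) (c : ℕ × ℕ) : CounterInstance :=
  ⟨m, ofFlowMachine F e, (e (.inl q), c), e (.inr false)⟩

/-- Exits are fixed points: if exit `x` is occupied at time `t` and exit `false` at time `u`, both
are occupied at `t + u`. -/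
theorem ofFlow_reaches {q : σ} {c c' : ℕ × ℕ} {x : Bool}
    (h : F.Reach (.inl q, c) (.inr x, c')) : (ofFlow F e q c).Reaches ↔ x = false := by
  obtain ⟨t, ht⟩ := ofFlowMachine_config F e h
  constructor
  · rintro ⟨u, hu⟩
    simp only [ofFlow, CounterMachine.config] at hu ht
    have h₁ : ((ofFlowMachine F e).step^[t + u] (e (.inl q), c)).1 = e (.inr x) := by
      rw [add_comm, Function.iterate_add_apply, ht, ofFlowMachine_iterate_exit]
    have h₂ : ((ofFlowMachine F e).step^[t + u] (e (.inl q), c)).1 = e (.inr false) := by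
      rw [Function.iterate_add_apply]
      obtain ⟨d, hd⟩ : ∃ d, (ofFlowMachine F e).step^[u] (e (.inl q), c) = (e (.inr false), d) :=
        ⟨_, Prod.ext hu rfl⟩
      rw [hd, ofFlowMachine_iterate_exit]
    simpa using h₁.symm.trans h₂
  · rintro rfl
    exact ⟨t, congrArg Prod.fst ht⟩

/-- Only the initial counters depend on `a`; the transition table is constant. -/
theorem ofFlow_primrec {α : Type*} [Primcodable α] (q : σ) {c : α → ℕ × ℕ} (hc : Primrec c) :
    Primrec fun a => ofFlow F e q (c a) :=
  primrec_of_toData <| (Primrec.const (ofFlow F e q (0, 0)).toData.1).pair <|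
    ((Primrec.const (e (.inl q) : ℕ)).pair hc).pair (Primrec.const (e (.inr false) : ℕ))

end Flow

open Finsupp in
/-- A partial recursive function can be simulated as far as zero and nonzero values go. -/
theorem exists_simulation {f : ℕ →. ℕ} (hf : Partrec f) :
    ∃ I : ℕ → CounterInstance, Primrec I ∧ ∀ n, ∀ a ∈ f n, ((I n).Reaches ↔ a = 0) := by
  -- Input in register 0, output in register 1, scratch from 2. A final decrement of register 1
  -- exits with `false` exactly when the output is zero.
  have prog := RegisterComputable.of_partrec' (Nat.Partrec'.part_iff₁.2 hf) 2 (fun _ => 0) 1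
    (by simp) (by simp) (by simp)
  obtain ⟨σ, hσ, F, q, hF⟩ := prog.test (RegisterTest.tryDec 1)
  obtain ⟨m, ⟨e⟩⟩ := Finite.exists_equiv_fin (σ ⊕ Bool)
  refine ⟨fun n => ofFlow F e q (Nat.nth Nat.Prime 0 ^ n, 0), ofFlow_primrec F e q ?_, ?_⟩
  · exact (Primrec₂.unpaired'.1 Nat.Primrec.pow |>.comp (Primrec.const _) Primrec.id).pair
      (Primrec.const 0)
  · intro n a ha
    have init : Registers.Below (single 0 n) 2 ∧ ∃ b ∈ f (List.Vector.ofFn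
        fun _ : Fin 1 => (single 0 n : Registers) 0).head, single 0 n + single 1 a =
        single 0 n + single 1 b :=
      ⟨fun j hj => by simp [show j ≠ 0 by omega], a, by simpa [List.Vector.ofFn] using ha, rfl⟩
    simp only [← Registers.code_single]
    rcases a with _ | a
    · have := hF (Registers.code (single 0 n), 0) false (Registers.code (single 0 n), 0)
        ⟨_, _, ⟨_, init, .inr ⟨rfl, by simp, rfl⟩⟩, rfl, by simp⟩
      simpa using ofFlow_reaches F e this
    · have := hF (Registers.code (single 0 n), 0) true
        (Registers.code (single 0 n + single 1 a), 0)
        ⟨_, _, ⟨_, init, .inl ⟨rfl, by rw [single_add, add_assoc]⟩⟩, rfl, rfl⟩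
      simpa using ofFlow_reaches F e this

/-! ### Leaving ones in the counters -/

/-- In the designated state `q` of a machine with `m` states, empty both counters and then put a
one into each of them, passing through the new states `m` and `m + 1`. -/
def onesRow (m q : ℕ) : CounterRow :=
  ((m, .inc₁), (q, .dec₂), (q, .dec₁), (q, .dec₁))

/-- The row with constant entry. -/
def constRow (e : CounterEntry) : CounterRow := (e, e, e, e)

/-- The data of the instance that cleans up after reaching the designated state. -/
def onesData (d : CounterData) : CounterData :=
  ((List.range d.1.length).map (fun j => if j = d.2.2 then onesRow d.1.length d.2.2
      -- The default row is never used, as `j` is less than the length.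
      else d.1.getD j (constRow (0, .stay))) ++
    [constRow (d.1.length + 1, .inc₂), constRow (d.1.length + 1, .stay)],
    d.2.1, d.1.length + 1)

theorem onesData_primrec : Primrec onesData := by
  have len : Primrec (fun d : CounterData => d.1.length) := Primrec.list_length.comp Primrec.fst
  have len' := Primrec.succ.comp len
  have halt : Primrec (fun d : CounterData => d.2.2) := Primrec.snd.comp Primrec.snd
  have entry : ∀ {α : Type} [Primcodable α] {f : α → ℕ} (a : CounterMove), Primrec f →
      Primrec fun x => (f x, a) := fun a hf => hf.pair (Primrec.const a)
  have const : ∀ {f : CounterData → CounterEntry}, Primrec f → Primrec fun d => constRow (f d) :=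
    fun hf => hf.pair (hf.pair (hf.pair hf))
  have ones : Primrec fun d : CounterData => onesRow d.1.length d.2.2 :=
    (entry _ len).pair ((entry _ halt).pair ((entry _ halt).pair (entry _ halt)))
  have row : Primrec₂ fun (d : CounterData) (j : ℕ) => if j = d.2.2 then onesRow d.1.length d.2.2
      else d.1.getD j (constRow (0, .stay)) :=
    Primrec.ite (Primrec.eq.comp Primrec.snd (halt.comp Primrec.fst)) (ones.comp Primrec.fst)
      ((Primrec.list_getD _).comp (Primrec.fst.comp Primrec.fst) Primrec.snd)
  exact (Primrec.list_append.comp (Primrec.list_map (Primrec.list_range.comp len) row)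
    (Primrec.list_cons.comp (const (entry .inc₂ len')) (Primrec.list_cons.comp
      (const (entry .stay len')) (Primrec.const [])))).pair
    ((Primrec.fst.comp Primrec.snd).pair len')

/-- The machine that cleans up after reaching the state `q`. -/
def onesMachine {m : ℕ} (M : CounterMachine m) (q : Fin m) : CounterMachine (m + 2) where
  Γ i b c :=
    if h : i.1 < m then
      if i.1 = q then
        match b, c with
        | false, false => (⟨m, by omega⟩, .inc₁)
        | false, true => (⟨q, by omega⟩, .dec₂)
        | true, _ => (⟨q, by omega⟩, .dec₁)
      else (⟨(M.Γ ⟨i, h⟩ b c).1, by omega⟩, (M.Γ ⟨i, h⟩ b c).2)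
    else if i.1 = m then (⟨m + 1, by omega⟩, .inc₂)
    else (⟨m + 1, by omega⟩, .stay)
  consistent₁ i b := by
    split_ifs
    · cases b <;> simp
    · exact M.consistent₁ _ b
    · simp
    · simp
  consistent₂ i b := by
    split_ifs
    · cases b <;> simp
    · exact M.consistent₂ _ b
    · simp
    · simp

/-- The instance that cleans up after reaching the designated state. -/
def withOnes (I : CounterInstance) : CounterInstance :=
  ⟨I.m + 2, onesMachine I.machine I.halt, (⟨I.init.1, by omega⟩, I.init.2), ⟨I.m + 1, by omega⟩⟩

/-- Links the machine, convenient for reasoning about runs, with the list operation, for which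
primitive recursiveness is checked. -/
theorem withOnes_toData (I : CounterInstance) : I.withOnes.toData = onesData I.toData := by
  refine Prod.ext ?_ (by simp [toData, withOnes, onesData])
  apply List.ext_getElem
  · simp [toData, withOnes, onesData]
  · intro j h₁ h₂
    have hj : j < I.m + 2 := by simpa only [toData, withOnes, List.length_ofFn] using h₁
    simp only [toData, withOnes, onesData, List.getElem_ofFn, onesMachine, List.length_ofFn,
      List.getElem_append, List.length_map, List.length_range, List.getElem_map,
      List.getElem_range]
    by_cases hm : j < I.m
    · by_cases hq : j = I.halt
      · simp [hq, onesRow]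
      · simp [hm, hq, List.getD_eq_getElem?_getD]
    · rcases (show j = I.m ∨ j = I.m + 1 by omega) with rfl | rfl <;> simp [constRow]

theorem withOnes_primrec : Primrec withOnes :=
  primrec_of_toData ((onesData_primrec.comp toData_primrec).of_eq fun I => (withOnes_toData I).symm)

/-- Invariant: state `m` is entered only from the old designated state with both counters empty, and
`m + 1` only from `m` or itself. -/
theorem withOnes_haltsWithOnes (I : CounterInstance) : I.withOnes.HaltsWithOnes := by
  suffices ∀ t, ((I.withOnes.machine.config I.withOnes.init t).1.1 = I.m →
      (I.withOnes.machine.config I.withOnes.init t).2 = (1, 0)) ∧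
      ((I.withOnes.machine.config I.withOnes.init t).1.1 = I.m + 1 →
      (I.withOnes.machine.config I.withOnes.init t).2 = (1, 1)) from
    fun t ht => (this t).2 (congrArg Fin.val ht)
  intro t
  induction t with
  | zero => simp [CounterMachine.config, withOnes]; omega
  | succ t ih =>
    rw [CounterMachine.config, Function.iterate_succ_apply', ← CounterMachine.config]
    generalize I.withOnes.machine.config I.withOnes.init t = s at ih
    obtain ⟨⟨i, hi⟩, a, b⟩ := s
    simp only [withOnes, CounterMachine.step, onesMachine] at hi ih ⊢
    split_ifs with h₁ h₂ h₃
    · have := I.halt.2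
      rcases Nat.eq_zero_or_pos a with rfl | ha
      · rcases Nat.eq_zero_or_pos b with rfl | hb
        · simp [CounterMove.apply]
        · simp only [hb, decide_true, lt_irrefl, decide_false]
          exact ⟨fun h => by omega, fun h => by omega⟩
      · simp only [ha, decide_true]
        exact ⟨fun h => by omega, fun h => by omega⟩
    · have := (I.machine.Γ ⟨i, h₁⟩ (decide (0 < a)) (decide (0 < b))).1.2
      exact ⟨fun h => by simp only at h; omega, fun h => by simp only at h; omega⟩
    · have := ih.1 h₃
      simp_all [CounterMove.apply]
    · have := ih.2 (by omega)
      simp_all [CounterMove.apply]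

/-- Configurations of the original machine are configurations of the one with clean-up. -/
def liftConfig {m : ℕ} (s : Fin m × ℕ × ℕ) : Fin (m + 2) × ℕ × ℕ :=
  (⟨s.1, by omega⟩, s.2)

/-- The two tables differ only at the designated state, so the runs agree up to and including its
first visit. -/
theorem withOnes_config (I : CounterInstance) (t : ℕ)
    (h : ∀ u < t, (I.machine.config I.init u).1 ≠ I.halt) :
    I.withOnes.machine.config I.withOnes.init t = liftConfig (I.machine.config I.init t) := by
  induction t with
  | zero => rfl
  | succ t ih =>
    have ht := h t (by omega)
    rw [CounterMachine.config, Function.iterate_succ_apply', ← CounterMachine.config,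
      ih fun u hu => h u (by omega), CounterMachine.config, CounterMachine.config,
      Function.iterate_succ_apply', ← CounterMachine.config]
    rw [ne_eq, Fin.ext_iff] at ht
    simp [liftConfig, withOnes, onesMachine, CounterMachine.step, ht]
    exact ⟨rfl, rfl⟩

/-- Each step at `q` removes one unit, first from the first counter and then from the second; from
empty counters two more steps suffice. -/
theorem onesMachine_reaches {m : ℕ} (M : CounterMachine m) (q : Fin m) (a b : ℕ) :
    ∃ t, (((onesMachine M q).config (liftConfig (q, a, b)) t).1 : ℕ) = m + 1 := by
  induction a with
  | zero =>
    induction b with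
    | zero =>
      refine ⟨2, ?_⟩
      simp [CounterMachine.config, CounterMachine.step, onesMachine, liftConfig]
    | succ b ih =>
      obtain ⟨t, ht⟩ := ih
      refine ⟨t + 1, ?_⟩
      rw [CounterMachine.config, Function.iterate_succ_apply, ← CounterMachine.config]
      convert ht using 4
      simp [CounterMachine.step, onesMachine, liftConfig, CounterMove.apply]
  | succ a ih =>
    obtain ⟨t, ht⟩ := ih
    refine ⟨t + 1, ?_⟩
    rw [CounterMachine.config, Function.iterate_succ_apply, ← CounterMachine.config]
    convert ht using 4
    simp [CounterMachine.step, onesMachine, liftConfig, CounterMove.apply]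

theorem withOnes_reaches (I : CounterInstance) : I.withOnes.Reaches ↔ I.Reaches := by
  classical
  constructor
  · rintro ⟨t, ht⟩
    by_contra hI
    have := withOnes_config I t fun u _ hu => hI ⟨u, hu⟩
    rw [this, Fin.ext_iff] at ht
    have := (I.machine.config I.init t).1.2
    simp only [liftConfig, withOnes] at ht
    omega
  · intro h
    have hc := withOnes_config I (Nat.find h) fun u hu => Nat.find_min h hu
    obtain ⟨c, hq⟩ : ∃ c, I.machine.config I.init (Nat.find h) = (I.halt, c) :=
      ⟨_, Prod.ext (Nat.find_spec h) rfl⟩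
    obtain ⟨t, ht⟩ := onesMachine_reaches I.machine I.halt c.1 c.2
    refine ⟨t + Nat.find h, Fin.ext ?_⟩
    rw [CounterMachine.config, Function.iterate_add_apply, ← CounterMachine.config,
      ← CounterMachine.config, hc, hq]
    exact ht

end CounterInstance

/-! ### The diagonal argument. -/

theorem mainTheorem5 :
    -- state reachability is undecidable
    (¬ ComputablePred CounterInstance.Reaches) ∧
    -- every instance can be replaced effectively by an equivalent one whose counters are equal
    -- to one whenever the designated state is reached
    (∃ g : CounterInstance → CounterInstance, Computable g ∧
      ∀ I, (g I).HaltsWithOnes ∧ ((g I).Reaches ↔ I.Reaches)) ∧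
    -- the problem restricted to such instances is undecidable
    (¬ ∃ f : CounterInstance →. Bool, Partrec f ∧
      ∀ I, I.HaltsWithOnes → ∃ b ∈ f I, (b = true ↔ I.Reaches)) := by
  have key : ¬ ∃ f : CounterInstance →. Bool, Partrec f ∧
      ∀ I, I.HaltsWithOnes → ∃ b ∈ f I, (b = true ↔ I.Reaches) := by
    rintro ⟨f, hf, h⟩
    obtain ⟨I, hI, hr⟩ := CounterInstance.exists_simulation
      (f := fun n => (Denumerable.ofNat Nat.Partrec.Code n).eval n)
      (Nat.Partrec.Code.eval_part.comp (Computable.ofNat _) Computable.id)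
    -- Value 0, which means reached, is returned exactly when the algorithm answers no.
    have hd : Partrec fun n : ℕ => (f (I n).withOnes).map fun b => cond b 1 0 :=
      (hf.comp (CounterInstance.withOnes_primrec.comp hI).to_comp).map
        (Computable.cond Computable.snd (Computable.const 1) (Computable.const 0)).to₂
    obtain ⟨c, hc⟩ := Nat.Partrec.Code.exists_code.1 (Partrec.nat_iff.1 hd)
    -- The algorithm terminates on this instance, so the diagonal function is defined at its own
    -- code and the simulation applies.
    obtain ⟨b, hb, hb'⟩ := h _ (I (Encodable.encode c)).withOnes_haltsWithOnes
    have := hr (Encodable.encode c) (cond b 1 0) (by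
      rw [Denumerable.ofNat_encode, hc]
      exact Part.mem_map _ hb)
    rw [CounterInstance.withOnes_reaches, this] at hb'
    cases b <;> simp at hb'
  refine ⟨fun hd => key ?_, ⟨_, CounterInstance.withOnes_primrec.to_comp, fun I =>
    ⟨I.withOnes_haltsWithOnes, I.withOnes_reaches⟩⟩, key⟩
  obtain ⟨_, hd⟩ := hd
  exact ⟨_, hd.partrec, fun I _ => ⟨_, Part.mem_some _, by simp⟩⟩
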